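/- Let $\alpha,\beta\in(0,1]$. A set $E\subseteq\mathbb{R}^2$ is called an $F_{\alpha\beta}$-set if there is a subset $L$ of the unit circle with Hausdorff dimension $\dim_H(L)\ge\beta$ such that, for every direction $e\in L$, there is a line segment $\ell_e\subseteq\mathbb{R}^2$ in the direction of $e$ with $\dim_H(E\cap\ell_e)\ge\alpha$. Then every $F_{\alpha\beta}$-set $E$ satisfies $$\dim_H(E)\ \ge\ \max\left\{2\alpha+\beta-1,\ \alpha+\frac{\beta}{2}\right\}.$$ -/

import Mathlib

/-- `E ⊆ ℝ²` is an `F_{αβ}`-set (intended for `α, β ∈ (0, 1]`): there is a set `L` of directions in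
the unit circle with `dim_H L ≥ β` such that, for every `e ∈ L`, some line segment `[a, a + r e]`
(`r > 0`) in the direction of `e` meets `E` in a set of Hausdorff dimension at least `α`.
Neither `E` nor `L` is assumed to be measurable. -/
def IsFurstenbergSet (α β : ℝ) (E : Set (EuclideanSpace ℝ (Fin 2))) : Prop :=
  ∃ L : Set (EuclideanSpace ℝ (Fin 2)),
    L ⊆ Metric.sphere (0 : EuclideanSpace ℝ (Fin 2)) 1 ∧
    ENNReal.ofReal β ≤ dimH L ∧
    ∀ e ∈ L, ∃ (a : EuclideanSpace ℝ (Fin 2)) (r : ℝ), 0 < r ∧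
      ENNReal.ofReal α ≤ dimH (E ∩ segment ℝ a (a + r • e))

open MeasureTheory Metric Set
open scoped ENNReal NNReal

/-! Take `a < α`, `b < β` and `dimH E < s`. Pigeonholing turns the problem into incidence counting
at one arbitrarily small scale `1 / R`, `R = 2 ^ k`: up to factors `R ^ O(η)`, there are at most `R
^ s` grid cells (`J`) and at least `R ^ b` lines with essentially `1 / R`-separated angles (`M`),
each meeting at least `A ≈ R ^ a` of the cells (`exists_lineConfig`).

Two counts bound `M * A ^ 2`. Each line contains about `A ^ 2` pairs of cells at distance at least
`d`, and such a pair fixes the angle up to `O(1 / d)` choices, so `M * A ^ 2 ≲ J ^ 2 / d` and `2 * a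
+ b ≤ 2 * s` (`card_mul_le_sq`). Alternatively, lines `m` and `m'` share `O(R / (|m - m'| + 1))`
cells, so Cauchy–Schwarz and a harmonic sum give `M * A ^ 2 ≲ J * R * log R` and `2 * a + b ≤ s + 1`
(`sq_card_mul_le`).

Contents serve as the measure of size: they are countably subadditive on arbitrary sets, so no
measurability is needed, and a lower bound on content bounds the number of cells from below. -/

/-- The `d`-dimensional Hausdorff content: like the Hausdorff measure, but with arbitrary covers. -/
noncomputable def hausdorffContent {X : Type*} [EMetricSpace X] (d : ℝ) : OuterMeasure X :=
  OuterMeasure.ofFunction (fun s => ⨆ _ : s.Nonempty, ediam s ^ d) (by simp)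

/-! ### Hausdorff content and dimension. -/

section Content

variable {X : Type*} [EMetricSpace X] {d : ℝ}

theorem hausdorffContent_le_ediam_rpow (s : Set X) : hausdorffContent d s ≤ ediam s ^ d :=
  (OuterMeasure.ofFunction_le s).trans (iSup_le fun _ => le_rfl)

/-- A cover with a small `d`-sum automatically consists of small sets, so zero content would make
the Hausdorff measure finite, while below the dimension it is infinite. -/
theorem hausdorffContent_ne_zero_of_lt_dimH (hd : 0 < d) {s : Set X}
    (h : ENNReal.ofReal d < dimH s) : hausdorffContent d s ≠ 0 := by
  borelize X
  intro h0
  have htop : μH[d] s = ∞ := by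
    have := hausdorffMeasure_of_lt_dimH (s := s) (d := d.toNNReal) h
    rwa [Real.coe_toNNReal _ hd.le] at this
  have hcov : ∀ ε : ℝ≥0∞, 0 < ε → ∃ t : ℕ → Set X, s ⊆ ⋃ n, t n ∧
      ∑' n, (⨆ _ : (t n).Nonempty, ediam (t n) ^ d) < ε := by
    intro ε hε
    rw [hausdorffContent, OuterMeasure.ofFunction_apply] at h0
    have : (⨅ (t : ℕ → Set X) (_ : s ⊆ iUnion t),
      ∑' n, (⨆ _ : (t n).Nonempty, ediam (t n) ^ d)) < ε := by rw [h0]; exact hε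
    simpa [iInf_lt_iff] using this
  have hle : μH[d] s ≤ 1 := by
    rw [Measure.hausdorffMeasure_apply]
    refine iSup₂_le fun r hr => ?_
    -- The bound `r ^ d` on the sum forces every diameter below `r`; the bound `1` controls the
    -- measure.
    obtain ⟨t, hst, ht⟩ := hcov (min 1 (r ^ d))
      (lt_min one_pos (ENNReal.rpow_pos_of_nonneg hr hd.le))
    refine (iInf₂_le t hst).trans ((iInf_le _ fun n => ?_).trans (ht.le.trans (min_le_left _ _)))
    rcases (t n).eq_empty_or_nonempty with he | he
    · simp [he]
    · rw [← ENNReal.rpow_le_rpow_iff hd]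
      calc ediam (t n) ^ d = ⨆ _ : (t n).Nonempty, ediam (t n) ^ d := by simp [he]
        _ ≤ ∑' n, (⨆ _ : (t n).Nonempty, ediam (t n) ^ d) := ENNReal.le_tsum n
        _ ≤ r ^ d := ht.le.trans (min_le_right _ _)
  rw [htop] at hle
  exact absurd hle (by simp)

theorem hausdorffContent_le_card_mul {ι : Type*} (f : X → ι) (T : Finset ι) {s : Set X} {r : ℝ≥0∞}
    (hd : 0 < d) (hf : ∀ x ∈ s, f x ∈ T)
    (hr : ∀ x ∈ s, ∀ y ∈ s, f x = f y → edist x y ≤ r) :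
    hausdorffContent d s ≤ T.card * r ^ d := by
  have hs : s ⊆ ⋃ i ∈ T, {x ∈ s | f x = i} := fun x hx => by simp [hx, hf x hx]
  calc hausdorffContent d s ≤ hausdorffContent d (⋃ i ∈ T, {x ∈ s | f x = i}) := measure_mono hs
    _ ≤ ∑ i ∈ T, hausdorffContent d {x ∈ s | f x = i} := measure_biUnion_finset_le T _
    _ ≤ ∑ i ∈ T, r ^ d := by
      refine Finset.sum_le_sum fun i _ => (hausdorffContent_le_ediam_rpow _).trans ?_
      refine ENNReal.rpow_le_rpow (ediam_le ?_) hd.le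
      rintro x ⟨hx, rfl⟩ y ⟨hy, hxy⟩
      exact hr x hx y hy hxy.symm
    _ = T.card * r ^ d := by simp

/-- A set of dimension less than `d` has covers by small sets with small `d`-dimensional sum. -/
theorem exists_cover_of_dimH_lt (hd : 0 < d) {s : Set X} (h : dimH s < ENNReal.ofReal d)
    {r : ℝ≥0∞} (hr : 0 < r) :
    ∃ t : ℕ → Set X, s ⊆ ⋃ n, t n ∧ (∀ n, ediam (t n) ≤ r) ∧ ∑' n, ediam (t n) ^ d ≤ 1 := by
  borelize X
  have h0 : μH[d] s = 0 := by
    have := hausdorffMeasure_of_dimH_lt (s := s) (d := d.toNNReal) h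
    rwa [Real.coe_toNNReal _ hd.le] at this
  rw [Measure.hausdorffMeasure_apply] at h0
  have h1 : (⨅ (t : ℕ → Set X) (_ : s ⊆ ⋃ n, t n) (_ : ∀ n, ediam (t n) ≤ r),
      ∑' n, ⨆ _ : (t n).Nonempty, ediam (t n) ^ d) < 1 := by
    refine lt_of_le_of_lt (le_of_le_of_eq ?_ h0) one_pos
    exact le_iSup₂ (f := fun (r : ℝ≥0∞) (_ : 0 < r) =>
      ⨅ (t : ℕ → Set X) (_ : s ⊆ ⋃ n, t n) (_ : ∀ n, ediam (t n) ≤ r),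
      ∑' n, ⨆ _ : (t n).Nonempty, ediam (t n) ^ d) r hr
  simp only [iInf_lt_iff] at h1
  obtain ⟨t, hst, ht, hsum⟩ := h1
  refine ⟨t, hst, ht, le_trans (ENNReal.tsum_le_tsum fun n => ?_) hsum.le⟩
  rcases (t n).eq_empty_or_nonempty with he | he
  · simp [he, hd]
  · simp [he]

end Content

/-! ### Directions and grid cells in the plane. -/

/-- The direction with angle `θ`. -/
noncomputable def dirVec (θ : ℝ) : EuclideanSpace ℝ (Fin 2) := !₂[Real.cos θ, Real.sin θ]

/-- The cell of the grid of side length `1 / R` containing `p`. -/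
noncomputable def gridCell (R : ℝ) (p : EuclideanSpace ℝ (Fin 2)) : ℤ × ℤ :=
  (⌊R * p 0⌋, ⌊R * p 1⌋)

@[simp] theorem dirVec_zero (θ : ℝ) : dirVec θ 0 = Real.cos θ := rfl
@[simp] theorem dirVec_one (θ : ℝ) : dirVec θ 1 = Real.sin θ := rfl

theorem norm_dirVec (θ : ℝ) : ‖dirVec θ‖ = 1 := by
  simp [EuclideanSpace.norm_eq, Fin.sum_univ_two]

theorem dist_le_abs_add_abs (p q : EuclideanSpace ℝ (Fin 2)) :
    dist p q ≤ |p 0 - q 0| + |p 1 - q 1| := by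
  rw [EuclideanSpace.dist_eq, Fin.sum_univ_two, Real.dist_eq, Real.dist_eq]
  refine Real.sqrt_le_iff.2 ⟨by positivity, ?_⟩
  nlinarith [abs_nonneg (p 0 - q 0), abs_nonneg (p 1 - q 1)]

theorem abs_sub_apply_le_dist (p q : EuclideanSpace ℝ (Fin 2)) (i : Fin 2) :
    |p i - q i| ≤ dist p q := by
  rw [dist_eq_norm, ← Real.norm_eq_abs]
  exact PiLp.norm_apply_le (p - q) i

theorem lipschitzWith_dirVec : LipschitzWith 2 dirVec := by
  refine LipschitzWith.of_dist_le_mul fun x y => (dist_le_abs_add_abs _ _).trans ?_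
  have h1 := Real.abs_cos_sub_cos_le x y
  have h2 := Real.abs_sin_sub_sin_le x y
  simp only [dirVec_zero, dirVec_one, Real.dist_eq]
  push_cast
  linarith

theorem exists_dirVec_eq {e : EuclideanSpace ℝ (Fin 2)} (he : ‖e‖ = 1) : ∃ θ, dirVec θ = e := by
  have h1 : e 0 ^ 2 + e 1 ^ 2 = 1 := by
    have := EuclideanSpace.real_norm_sq_eq e
    rw [he, Fin.sum_univ_two] at this
    linarith
  have hz : ‖(⟨e 0, e 1⟩ : ℂ)‖ = 1 := by
    rw [Complex.norm_def, Complex.normSq_mk, Real.sqrt_eq_one]; linarith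
  refine ⟨Complex.arg ⟨e 0, e 1⟩, ?_⟩
  have hc := Complex.norm_mul_cos_arg ⟨e 0, e 1⟩
  have hs := Complex.norm_mul_sin_arg ⟨e 0, e 1⟩
  rw [hz, one_mul] at hc hs
  ext i
  fin_cases i
  · simpa using hc
  · simpa using hs

theorem dist_le_of_gridCell_eq {R : ℝ} (hR : 0 < R) {p q : EuclideanSpace ℝ (Fin 2)}
    (h : gridCell R p = gridCell R q) : dist p q ≤ 2 / R := by
  obtain ⟨h0, h1⟩ := Prod.ext_iff.1 h
  have h0' := Int.abs_sub_lt_one_of_floor_eq_floor h0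
  have h1' := Int.abs_sub_lt_one_of_floor_eq_floor h1
  rw [← mul_sub, abs_mul, abs_of_pos hR] at h0' h1'
  refine (dist_le_abs_add_abs p q).trans ?_
  rw [le_div_iff₀ hR]
  linarith

/-- The block of nine cells around a cell. -/
noncomputable def cellBlock (z : ℤ × ℤ) : Finset (ℤ × ℤ) :=
  Finset.Icc (z.1 - 1) (z.1 + 1) ×ˢ Finset.Icc (z.2 - 1) (z.2 + 1)

theorem card_cellBlock (z : ℤ × ℤ) : (cellBlock z).card = 9 := by
  simp only [cellBlock, Finset.card_product, Int.card_Icc]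
  ring_nf; rfl

theorem floor_mem_Icc_of_abs_sub_le {x y : ℝ} (h : |x - y| ≤ 1) :
    ⌊x⌋ ∈ Finset.Icc (⌊y⌋ - 1) (⌊y⌋ + 1) := by
  rw [abs_le] at h
  rw [Finset.mem_Icc]
  constructor
  · rw [← Int.floor_sub_one]; exact Int.floor_mono (by linarith)
  · rw [← Int.floor_add_one]; exact Int.floor_mono (by linarith)

theorem gridCell_mem_cellBlock {R : ℝ} (hR : 0 < R) {p q : EuclideanSpace ℝ (Fin 2)}
    (h : dist p q ≤ 1 / R) : gridCell R p ∈ cellBlock (gridCell R q) := by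
  have key : ∀ i, |R * p i - R * q i| ≤ 1 := fun i => by
    rw [← mul_sub, abs_mul, abs_of_pos hR]
    have := (abs_sub_apply_le_dist p q i).trans h
    rw [le_div_iff₀ hR] at this
    linarith
  rw [cellBlock, Finset.mem_product]
  exact ⟨floor_mem_Icc_of_abs_sub_le (key 0), floor_mem_Icc_of_abs_sub_le (key 1)⟩

/-! ### Pigeonholing to uniform pieces and a single scale. -/

theorem exists_le_of_tsum_lt {X : Type*} (μ : OuterMeasure X) {A : Set X} {B : ℕ → Set X}
    {w : ℕ → ℝ≥0∞} (hAB : A ⊆ ⋃ k, B k) (h : ∑' k, w k < μ A) : ∃ k, w k ≤ μ (B k) := by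
  by_contra! hcon
  refine h.not_ge ?_
  calc μ A ≤ μ (⋃ k, B k) := measure_mono hAB
    _ ≤ ∑' k, μ (B k) := measure_iUnion_le B
    _ ≤ ∑' k, w k := ENNReal.tsum_le_tsum fun k => (hcon k).le

/-- Every Furstenberg set contains, for a non-null set of angles in an interval of length one,
uniformly large subsets of bounded pieces of lines with these angles. -/
theorem IsFurstenbergSet.exists_angles {α β : ℝ} {E : Set (EuclideanSpace ℝ (Fin 2))}
    (hE : IsFurstenbergSet α β E) {a b : ℝ} (ha : 0 < a) (hb : 0 < b) (haα : a < α) (hbβ : b < β) :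
    ∃ (x : ℝ) (Θ : Set ℝ) (S : ℝ → Set (EuclideanSpace ℝ (Fin 2))) (c : ℝ≥0∞),
      c ≠ 0 ∧ Θ ⊆ Icc x (x + 1) ∧ hausdorffContent b Θ ≠ 0 ∧
      ∀ θ ∈ Θ, S θ ⊆ E ∧ c ≤ hausdorffContent a (S θ) ∧
        ∀ p ∈ S θ, ∀ q ∈ S θ, dist p q ≤ 2 ∧ ∃ t : ℝ, q - p = t • dirVec θ := by
  obtain ⟨L, hL, hdim, hseg⟩ := hE
  have h1 : ∀ θ, ∃ S : Set (EuclideanSpace ℝ (Fin 2)), dirVec θ ∈ L →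
      S ⊆ E ∧ hausdorffContent a S ≠ 0 ∧
        ∀ p ∈ S, ∀ q ∈ S, dist p q ≤ 2 ∧ ∃ t : ℝ, q - p = t • dirVec θ := by
    intro θ
    by_cases hθ : dirVec θ ∈ L
    swap
    · exact ⟨∅, fun h => absurd h hθ⟩
    obtain ⟨o, r, hr, hd⟩ := hseg _ hθ
    set F := E ∩ segment ℝ o (o + r • dirVec θ)
    have hpos : hausdorffContent a F ≠ 0 :=
      hausdorffContent_ne_zero_of_lt_dimH ha
        (((ENNReal.ofReal_lt_ofReal_iff (ha.trans haα)).2 haα).trans_le hd)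
    -- Countably many unit cells cover the segment, so one of them keeps positive content; this
    -- bounds the diameter by `2`.
    obtain ⟨z, hz⟩ : ∃ z, hausdorffContent a {p ∈ F | gridCell 1 p = z} ≠ 0 := by
      by_contra! hcon
      refine hpos (measure_mono_null ?_ (measure_iUnion_null hcon))
      intro p hp
      exact mem_iUnion.2 ⟨gridCell 1 p, hp, rfl⟩
    refine ⟨_, fun _ => ⟨fun p hp => hp.1.1, hz, ?_⟩⟩
    rintro p ⟨⟨-, hp⟩, hpz⟩ q ⟨⟨-, hq⟩, hqz⟩
    refine ⟨by simpa using dist_le_of_gridCell_eq one_pos (hpz.trans hqz.symm), ?_⟩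
    rw [segment_eq_image'] at hp hq
    obtain ⟨u, -, rfl⟩ := hp
    obtain ⟨v, -, rfl⟩ := hq
    refine ⟨(v - u) * r, ?_⟩
    simp only [add_sub_cancel_left, smul_smul, sub_mul, sub_smul]
    abel
  choose S hS using h1
  have hΘ : hausdorffContent b (dirVec ⁻¹' L) ≠ 0 := by
    refine hausdorffContent_ne_zero_of_lt_dimH hb
      (((ENNReal.ofReal_lt_ofReal_iff (hb.trans hbβ)).2 hbβ).trans_le (hdim.trans ?_))
    calc dimH L ≤ dimH (dirVec '' (dirVec ⁻¹' L)) := by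
          refine dimH_mono fun e he => ?_
          obtain ⟨θ, rfl⟩ := exists_dirVec_eq (mem_sphere_zero_iff_norm.1 (hL he))
          exact ⟨θ, he, rfl⟩
      _ ≤ _ := lipschitzWith_dirVec.dimH_image_le _
  -- Splitting by the integer part of the angle and by the threshold `1 / (m + 1)` localizes the
  -- angles and makes the content bound uniform at once.
  obtain ⟨⟨n, m⟩, hnm⟩ : ∃ i : ℤ × ℕ, hausdorffContent b {θ ∈ dirVec ⁻¹' L | ⌊θ⌋ = i.1 ∧
      ((i.2 : ℝ≥0∞) + 1)⁻¹ ≤ hausdorffContent a (S θ)} ≠ 0 := by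
    by_contra! hcon
    refine hΘ (measure_mono_null ?_ (measure_iUnion_null hcon))
    intro θ hθ
    obtain ⟨m, hm⟩ := ENNReal.exists_inv_nat_lt (hS θ hθ).2.1
    refine mem_iUnion.2 ⟨(⌊θ⌋, m), hθ, rfl, le_trans ?_ hm.le⟩
    exact ENNReal.inv_le_inv.2 le_self_add
  refine ⟨n, _, S, ((m : ℝ≥0∞) + 1)⁻¹, by simp, ?_, hnm, ?_⟩
  · rintro θ ⟨-, h, -⟩
    rw [Int.floor_eq_iff] at h
    exact ⟨h.1, h.2.le⟩
  · rintro θ ⟨hθ, -, h⟩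
    exact ⟨(hS θ hθ).1, h, (hS θ hθ).2.2⟩

theorem exists_dyadic_between {x : ℝ≥0∞} (hx : x ≠ 0) {K : ℕ} (hK : x ≤ 2⁻¹ ^ K) :
    ∃ k, K ≤ k ∧ 2⁻¹ ^ (k + 1) < x ∧ x ≤ 2⁻¹ ^ k := by
  classical
  have hex : ∃ n : ℕ, (2⁻¹ : ℝ≥0∞) ^ n < x := by
    obtain ⟨n, hn⟩ := ENNReal.exists_inv_two_pow_lt hx
    exact ⟨n, by simpa using hn⟩
  have hlt : K < Nat.find hex := by
    rw [Nat.lt_find_iff]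
    intro m hm
    exact not_lt.2 (hK.trans (pow_le_pow_right_of_le_one' (by simp) hm))
  refine ⟨Nat.find hex - 1, by omega, ?_, ?_⟩
  · rw [Nat.sub_add_cancel (by omega)]
    exact Nat.find_spec hex
  · exact not_lt.1 (Nat.find_min hex (by omega))

/-- A set of dimension less than `s` is covered, up to a null set, by few grid cells of each dyadic
side length. -/
theorem exists_dyadic_cover {E : Set (EuclideanSpace ℝ (Fin 2))} {s : ℝ} (hs : 0 < s)
    (hE : dimH E < ENNReal.ofReal s) (K : ℕ) :
    ∃ (J : ℕ → Finset (ℤ × ℤ)) (Z : Set (EuclideanSpace ℝ (Fin 2))),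
      (∀ a : ℝ, 0 < a → hausdorffContent a Z = 0) ∧
      (∀ k, ((J k).card : ℝ) ≤ 9 * (2 : ℝ) ^ ((k + 1) * s)) ∧
      ∀ p ∈ E, p ∈ Z ∨ ∃ k, K ≤ k ∧ gridCell (2 ^ k) p ∈ J k := by
  classical
  obtain ⟨t, hEt, htK, hsum⟩ := exists_cover_of_dimH_lt hs hE (r := 2⁻¹ ^ K)
    (ENNReal.pow_pos (by simp) K)
  -- Markov's inequality: the `s`-sum is at most `1`, so few sets of the cover have diameter at
  -- least `2 ^ -(k + 1)`.
  have hfin : ∀ k : ℕ, ∃ N : Finset ℕ, (∀ n, (2⁻¹ : ℝ≥0∞) ^ (k + 1) ≤ ediam (t n) → n ∈ N) ∧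
      (N.card : ℝ) ≤ (2 : ℝ) ^ ((k + 1) * s) := by
    intro k
    have hpos : ((2⁻¹ : ℝ≥0∞) ^ (k + 1)) ^ s ≠ 0 :=
      (ENNReal.rpow_pos (ENNReal.pow_pos (by simp) _) (by finiteness)).ne'
    obtain ⟨hf, hcard⟩ := ENNReal.finset_card_const_le_le_of_tsum_le ENNReal.one_ne_top hsum hpos
    refine ⟨hf.toFinset, fun n hn => by simpa using ENNReal.rpow_le_rpow hn hs.le, ?_⟩
    have hval : (1 : ℝ≥0∞) / ((2⁻¹ : ℝ≥0∞) ^ (k + 1)) ^ s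
        = ENNReal.ofReal ((2 : ℝ) ^ ((k + 1) * s)) := by
      rw [← ENNReal.rpow_natCast, ← ENNReal.rpow_mul, ENNReal.inv_rpow, one_div, inv_inv,
        ← ENNReal.ofReal_rpow_of_pos two_pos]
      push_cast
      simp
    rw [hval] at hcard
    rwa [← ENNReal.ofReal_natCast, ENNReal.ofReal_le_ofReal_iff (by positivity)] at hcard
  choose N hN hNcard using hfin
  have hpt : ∀ n, ∃ q, (t n).Nonempty → q ∈ t n := fun n => by
    rcases (t n).eq_empty_or_nonempty with h | ⟨q, hq⟩
    · exact ⟨0, fun h' => absurd h h'.ne_empty⟩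
    · exact ⟨q, fun _ => hq⟩
  choose q hq using hpt
  -- A set of diameter at most `2 ^ -k` lies in the block around the cell of any of its points. Sets
  -- of diameter zero have no dyadic scale; they form `Z`.
  refine ⟨fun k => (N k).biUnion fun n => cellBlock (gridCell (2 ^ k) (q n)),
    ⋃ (n) (_ : ediam (t n) = 0), t n, fun a ha => ?_, fun k => ?_, fun p hp => ?_⟩
  · refine measure_iUnion_null fun n => measure_iUnion_null fun hn => ?_
    refine le_antisymm ((hausdorffContent_le_ediam_rpow _).trans ?_) zero_le
    simp [hn, ha]
  · have : ((N k).biUnion fun n => cellBlock (gridCell (2 ^ k) (q n))).card ≤ (N k).card * 9 :=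
      Finset.card_biUnion_le_card_mul _ _ _ fun n _ => (card_cellBlock _).le
    have h' : (((N k).biUnion fun n => cellBlock (gridCell (2 ^ k) (q n))).card : ℝ)
        ≤ (N k).card * 9 := by exact_mod_cast this
    linarith [hNcard k]
  · obtain ⟨n, hn⟩ := mem_iUnion.1 (hEt hp)
    by_cases h0 : ediam (t n) = 0
    · exact Or.inl (mem_iUnion₂.2 ⟨n, h0, hn⟩)
    · obtain ⟨k, hKk, hk1, hk2⟩ := exists_dyadic_between h0 (htK n)
      refine Or.inr ⟨k, hKk, Finset.mem_biUnion.2 ⟨n, hN k n hk1.le, ?_⟩⟩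
      refine gridCell_mem_cellBlock (by positivity) ?_
      have hd : edist p (q n) ≤ 2⁻¹ ^ k :=
        (edist_le_ediam_of_mem hn (hq n ⟨p, hn⟩)).trans hk2
      rw [edist_dist] at hd
      have he : (2⁻¹ : ℝ≥0∞) ^ k = ENNReal.ofReal (1 / 2 ^ k) := by
        rw [one_div, ← inv_pow, ENNReal.ofReal_pow (by positivity),
          ENNReal.ofReal_inv_of_pos two_pos]
        simp
      rwa [he, ENNReal.ofReal_le_ofReal_iff (by positivity)] at hd

/-- Pigeonholing of a scale at which both many angles and large parts of the sets `S θ` are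
captured by few grid cells. -/
theorem exists_scale {E : Set (EuclideanSpace ℝ (Fin 2))} {s a b η : ℝ} (hs : 0 < s) (ha : 0 < a)
    (hη : 0 < η) (hE : dimH E < ENNReal.ofReal s)
    {Θ : Set ℝ} {S : ℝ → Set (EuclideanSpace ℝ (Fin 2))} {c : ℝ≥0∞} (hc : c ≠ 0)
    (hΘ : hausdorffContent b Θ ≠ 0)
    (hS : ∀ θ ∈ Θ, S θ ⊆ E ∧ c ≤ hausdorffContent a (S θ)) (k₀ : ℕ) :
    ∃ (k : ℕ) (J : Finset (ℤ × ℤ)), k₀ ≤ k ∧ (J.card : ℝ) ≤ 9 * (2 : ℝ) ^ ((k + 1) * s) ∧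
      ENNReal.ofReal ((2 : ℝ) ^ (-(η * k))) ≤ hausdorffContent b
        {θ ∈ Θ | ENNReal.ofReal ((2 : ℝ) ^ (-(η * k))) ≤
          hausdorffContent a {p ∈ S θ | gridCell (2 ^ k) p ∈ J}} := by
  set w : ℕ → ℝ≥0∞ := fun k => ENNReal.ofReal ((2 : ℝ) ^ (-(η * k))) with hw
  have hwsum : ∑' k, w k ≠ ∞ := by
    have hsm : Summable fun k : ℕ => (2 : ℝ) ^ (-(η * k)) := by
      have h2 : (2 : ℝ) ^ (-η) < 1 := Real.rpow_lt_one_of_one_lt_of_neg one_lt_two (by linarith)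
      refine (summable_geometric_of_lt_one (by positivity) h2).congr fun k => ?_
      rw [← Real.rpow_natCast, ← Real.rpow_mul two_pos.le, neg_mul]
    exact hsm.tsum_ofReal_ne_top
  -- One tail of the weights lies below both `c` and the content of `Θ`, so it serves both
  -- pigeonholes: first over scales for each angle, then over scales for the set of angles.
  obtain ⟨K, hK, hKlt⟩ : ∃ K, k₀ ≤ K ∧ ∑' k, w (k + K) < min c (hausdorffContent b Θ) := by
    have ht := ENNReal.tendsto_sum_nat_add w hwsum
    have hpos : 0 < min c (hausdorffContent b Θ) :=
      lt_min (pos_iff_ne_zero.2 hc) (pos_iff_ne_zero.2 hΘ)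
    obtain ⟨K, h1, h2⟩ := ((ht.eventually (gt_mem_nhds hpos)).and
      (Filter.eventually_ge_atTop k₀)).exists
    exact ⟨K, h2, h1⟩
  obtain ⟨J, Z, hZ, hJ, hcov⟩ := exists_dyadic_cover hs hE K
  obtain ⟨k, hk⟩ := exists_le_of_tsum_lt (hausdorffContent b) (A := Θ)
    (B := fun k => {θ ∈ Θ | w (k + K) ≤
      hausdorffContent a {p ∈ S θ | gridCell (2 ^ (k + K)) p ∈ J (k + K)}})
    (w := fun k => w (k + K)) (fun θ hθ => by
      have hlt : ∑' k, w (k + K) < hausdorffContent a (S θ \ Z) := by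
        refine (hKlt.trans_le (min_le_left _ _)).trans_le ((hS θ hθ).2.trans ?_)
        calc hausdorffContent a (S θ) ≤ hausdorffContent a ((S θ \ Z) ∪ Z) :=
              measure_mono (by simp)
          _ ≤ hausdorffContent a (S θ \ Z) + hausdorffContent a Z := measure_union_le _ _
          _ = _ := by rw [hZ a ha, add_zero]
      obtain ⟨k, hk⟩ := exists_le_of_tsum_lt (hausdorffContent a)
        (B := fun k => {p ∈ S θ | gridCell (2 ^ (k + K)) p ∈ J (k + K)})
        (fun p hp => by
          obtain ⟨k, hKk, hk⟩ := (hcov p ((hS θ hθ).1 hp.1)).resolve_left hp.2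
          refine mem_iUnion.2 ⟨k - K, hp.1, ?_⟩
          rwa [Nat.sub_add_cancel hKk]) hlt
      exact mem_iUnion.2 ⟨k, hθ, hk⟩)
    (hKlt.trans_le (min_le_right _ _))
  exact ⟨k + K, J (k + K), by omega, hJ _, hk⟩

/-! ### Counting cells on lines. -/

theorem le_card_of_le_hausdorffContent {a κ R : ℝ} (ha : 0 < a) (hR : 0 < R)
    {S : Set (EuclideanSpace ℝ (Fin 2))} {T : Finset (ℤ × ℤ)} (hT : ∀ p ∈ S, gridCell R p ∈ T)
    (hκ : ENNReal.ofReal κ ≤ hausdorffContent a S) : κ * (R / 2) ^ a ≤ T.card := by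
  have h := hκ.trans (hausdorffContent_le_card_mul (gridCell R) T (r := ENNReal.ofReal (2 / R)) ha hT
    fun x _ y _ hxy => by
      rw [edist_dist]; exact ENNReal.ofReal_le_ofReal (dist_le_of_gridCell_eq hR hxy))
  rw [ENNReal.ofReal_rpow_of_pos (by positivity), ← ENNReal.ofReal_natCast,
    ← ENNReal.ofReal_mul (by positivity), ENNReal.ofReal_le_ofReal_iff (by positivity)] at h
  have h2 : (2 / R) ^ a * (R / 2) ^ a = 1 := by
    rw [← Real.mul_rpow (by positivity) (by positivity)]
    field_simp
    simp
  calc κ * (R / 2) ^ a ≤ T.card * (2 / R) ^ a * (R / 2) ^ a := by gcongr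
    _ = T.card := by rw [mul_assoc, h2, mul_one]

/-- Two lines which share two grid cells have nearby angles if these cells are far apart. -/
theorem dist_mul_abs_sub_le {R θ θ' t t' : ℝ} (hR : 0 < R) (hθ : |θ - θ'| ≤ 1)
    {p q p' q' : EuclideanSpace ℝ (Fin 2)} (ht : q - p = t • dirVec θ) (ht' : q' - p' = t' • dirVec θ')
    (hp : gridCell R p = gridCell R p') (hq : gridCell R q = gridCell R q') :
    dist p q * |θ - θ'| ≤ 16 / R := by
  have hpd := dist_le_of_gridCell_eq hR hp
  have hqd := dist_le_of_gridCell_eq hR hq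
  have hcoord : ∀ i, |t * dirVec θ i - t' * dirVec θ' i| ≤ 4 / R := fun i => by
    have h1 : q i - p i = t * dirVec θ i := by simpa using congrArg (fun v => v i) ht
    have h2 : q' i - p' i = t' * dirVec θ' i := by simpa using congrArg (fun v => v i) ht'
    rw [← h1, ← h2]
    have h3 := (abs_sub_apply_le_dist p p' i).trans hpd
    have h4 := (abs_sub_apply_le_dist q q' i).trans hqd
    have : (4 : ℝ) / R = 2 / R + 2 / R := by ring
    rw [this]
    rw [abs_le] at *
    constructor <;> linarith [h3.1, h3.2, h4.1, h4.2]
  have h0 := hcoord 0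
  have h1 := hcoord 1
  simp only [dirVec_zero, dirVec_one] at h0 h1
  have hdist : dist p q = |t| := by
    rw [dist_comm, dist_eq_norm, ht, norm_smul, norm_dirVec, mul_one, Real.norm_eq_abs]
  have hsin : |t| * |Real.sin (θ - θ')| ≤ 8 / R := by
    -- The cross product with the direction `θ'` eliminates `t'`.
    have heq : t * Real.sin (θ - θ') = (t * Real.sin θ - t' * Real.sin θ') * Real.cos θ'
        - (t * Real.cos θ - t' * Real.cos θ') * Real.sin θ' := by
      rw [Real.sin_sub]; ring
    rw [← abs_mul, heq]
    refine (abs_sub _ _).trans ?_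
    rw [abs_mul, abs_mul]
    have hc := Real.abs_cos_le_one θ'
    have hs := Real.abs_sin_le_one θ'
    have : (8 : ℝ) / R = 4 / R * 1 + 4 / R * 1 := by ring
    rw [this]
    gcongr
  have hlow : |θ - θ'| ≤ 2 * |Real.sin (θ - θ')| := by
    have h := Real.mul_abs_le_abs_sin (x := θ - θ') (hθ.trans (by linarith [Real.pi_gt_three]))
    have hpi : (1 : ℝ) / 2 ≤ 2 / Real.pi := by
      rw [div_le_div_iff₀ two_pos Real.pi_pos]; linarith [Real.pi_le_four]
    nlinarith [abs_nonneg (θ - θ')]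
  rw [hdist]
  calc |t| * |θ - θ'| ≤ |t| * (2 * |Real.sin (θ - θ')|) := by gcongr
    _ = 2 * (|t| * |Real.sin (θ - θ')|) := by ring
    _ ≤ 2 * (8 / R) := by gcongr
    _ = 16 / R := by ring

/-- Number of grid cells met by a subset of a line. -/
theorem card_le_of_subset_line {R D θ : ℝ} (hR : 0 < R) (hD : 0 ≤ D)
    {S : Set (EuclideanSpace ℝ (Fin 2))}
    (hS : ∀ p ∈ S, ∀ q ∈ S, dist p q ≤ D ∧ ∃ t : ℝ, q - p = t • dirVec θ)
    {T : Finset (ℤ × ℤ)} (hT : ∀ z ∈ T, ∃ p ∈ S, gridCell R p = z) :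
    (T.card : ℝ) ≤ 9 * (2 * (R * D) + 2) := by
  classical
  rcases T.eq_empty_or_nonempty with rfl | ⟨z₀, hz₀⟩
  · simp; positivity
  obtain ⟨p₀, hp₀, -⟩ := hT z₀ hz₀
  -- Mark points at spacing `1 / R` along the line through `p₀`; every point of `S` is within `1 /
  -- R` of a mark.
  have hsub : T ⊆ (Finset.Icc ⌊-(R * D)⌋ ⌊R * D⌋).biUnion fun j =>
      cellBlock (gridCell R (p₀ + ((j : ℝ) / R) • dirVec θ)) := by
    intro z hz
    obtain ⟨p, hp, rfl⟩ := hT z hz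
    obtain ⟨hd, t, ht⟩ := hS p₀ hp₀ p hp
    have hpt : p = p₀ + t • dirVec θ := by rw [← ht]; abel
    have htD : |t| ≤ D := by
      rwa [dist_comm, dist_eq_norm, ht, norm_smul, norm_dirVec, mul_one, Real.norm_eq_abs] at hd
    rw [abs_le] at htD
    refine Finset.mem_biUnion.2 ⟨⌊R * t⌋, Finset.mem_Icc.2
      ⟨Int.floor_mono (by nlinarith), Int.floor_mono (by nlinarith)⟩, ?_⟩
    refine gridCell_mem_cellBlock hR ?_
    rw [hpt, dist_add_left, dist_eq_norm, ← sub_smul, norm_smul, norm_dirVec, mul_one,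
      Real.norm_eq_abs, abs_le]
    have h1 := Int.floor_le (R * t)
    have h2 := Int.lt_floor_add_one (R * t)
    have h3 : t - (⌊R * t⌋ : ℝ) / R = (R * t - ⌊R * t⌋) / R := by field_simp
    rw [h3]
    constructor
    · have : 0 ≤ (R * t - ⌊R * t⌋) / R := div_nonneg (by linarith) hR.le
      have : 0 < 1 / R := by positivity
      linarith
    · gcongr; linarith
  have hcard := (Finset.card_le_card hsub).trans
    (Finset.card_biUnion_le_card_mul _ _ 9 fun j _ => (card_cellBlock _).le)
  rw [Int.card_Icc] at hcard
  have hle : ⌊-(R * D)⌋ ≤ ⌊R * D⌋ := Int.floor_mono (by nlinarith)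
  have hN : (((⌊R * D⌋ + 1 - ⌊-(R * D)⌋).toNat : ℕ) : ℝ) ≤ 2 * (R * D) + 2 := by
    rw [← Int.cast_natCast, Int.toNat_of_nonneg (by omega)]
    push_cast
    have h1 := Int.floor_le (R * D)
    have h2 := Int.lt_floor_add_one (-(R * D))
    linarith
  have : (T.card : ℝ) ≤ (((⌊R * D⌋ + 1 - ⌊-(R * D)⌋).toNat : ℕ) : ℝ) * 9 := by exact_mod_cast hcard
  linarith

theorem card_le_of_abs_sub_le {M : Finset ℤ} {B : ℝ} (hB : 0 ≤ B)
    (h : ∀ m ∈ M, ∀ m' ∈ M, |(m : ℝ) - m'| ≤ B) : (M.card : ℝ) ≤ 2 * B + 1 := by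
  rcases M.eq_empty_or_nonempty with rfl | ⟨m₀, hm₀⟩
  · simp; positivity
  have hsub : M ⊆ Finset.Icc (m₀ - ⌊B⌋) (m₀ + ⌊B⌋) := by
    intro m hm
    have h1 := abs_le.1 (h m hm m₀ hm₀)
    have h2 : m - m₀ ≤ ⌊B⌋ := Int.le_floor.2 (by push_cast; linarith)
    have h3 : m₀ - m ≤ ⌊B⌋ := Int.le_floor.2 (by push_cast; linarith)
    rw [Finset.mem_Icc]; omega
  have hcard := Finset.card_le_card hsub
  rw [Int.card_Icc] at hcard
  have h0 : 0 ≤ ⌊B⌋ := Int.floor_nonneg.2 hB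
  have h1 : (M.card : ℤ) ≤ 2 * ⌊B⌋ + 1 := by omega
  have h2 : (M.card : ℝ) ≤ 2 * (⌊B⌋ : ℝ) + 1 := by exact_mod_cast h1
  linarith [Int.floor_le B]

/-- Cauchy–Schwarz for the number of sets `I m` through each cell of `J`. -/
theorem sq_sum_card_le {ι κ : Type*} [DecidableEq κ] (M : Finset ι) (J : Finset κ)
    (I : ι → Finset κ) (hI : ∀ m ∈ M, I m ⊆ J) :
    (∑ m ∈ M, ((I m).card : ℝ)) ^ 2
      ≤ J.card * ∑ m ∈ M, ∑ m' ∈ M, ((I m ∩ I m').card : ℝ) := by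
  have h1 : ∀ A : Finset κ, A ⊆ J → (A.card : ℝ) = ∑ z ∈ J, if z ∈ A then 1 else 0 := by
    intro A hA
    rw [Finset.sum_boole, Finset.filter_mem_eq_inter, Finset.inter_eq_right.2 hA]
  have h2 : ∑ m ∈ M, ((I m).card : ℝ) = ∑ z ∈ J, ∑ m ∈ M, if z ∈ I m then (1 : ℝ) else 0 := by
    rw [Finset.sum_comm]
    exact Finset.sum_congr rfl fun m hm => h1 _ (hI m hm)
  have h3 : ∑ m ∈ M, ∑ m' ∈ M, ((I m ∩ I m').card : ℝ)
      = ∑ z ∈ J, (∑ m ∈ M, if z ∈ I m then (1 : ℝ) else 0) ^ 2 := by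
    simp_rw [pow_two, Finset.sum_mul_sum]
    symm
    rw [Finset.sum_comm]
    refine Finset.sum_congr rfl fun m hm => ?_
    rw [Finset.sum_comm]
    refine Finset.sum_congr rfl fun m' _ => ?_
    symm
    rw [h1 _ (Finset.inter_subset_left.trans (hI m hm))]
    refine Finset.sum_congr rfl fun z _ => ?_
    by_cases hz : z ∈ I m <;> by_cases hz' : z ∈ I m' <;> simp [hz, hz']
  rw [h2, h3]
  exact sq_sum_le_card_mul_sum_sq

/-- Each distance from `m` occurs at most twice, which leaves a harmonic sum. -/
theorem sum_inv_abs_sub_le (M : Finset ℤ) (m : ℤ) (N : ℕ)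
    (h : ∀ m' ∈ M, (m - m').natAbs < N) :
    ∑ m' ∈ M, 1 / (|(m : ℝ) - m'| + 1) ≤ 2 * (1 + Real.log N) := by
  classical
  have hmaps : ∀ m' ∈ M, (m - m').natAbs ∈ Finset.range N := fun m' hm' => by simpa using h m' hm'
  rw [← Finset.sum_fiberwise_of_maps_to hmaps]
  have hfib : ∀ n ∈ Finset.range N, ∑ m' ∈ M with (m - m').natAbs = n, 1 / (|(m : ℝ) - m'| + 1)
      ≤ 2 * ((n : ℝ) + 1)⁻¹ := by
    intro n _
    have heq : ∑ m' ∈ M with (m - m').natAbs = n, 1 / (|(m : ℝ) - m'| + 1)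
        = ∑ m' ∈ M with (m - m').natAbs = n, ((n : ℝ) + 1)⁻¹ := by
      refine Finset.sum_congr rfl fun m' hm' => ?_
      have hn := (Finset.mem_filter.1 hm').2
      have : |(m : ℝ) - m'| = n := by
        rw [← hn, Nat.cast_natAbs]; push_cast; rfl
      rw [this, one_div]
    rw [heq, Finset.sum_const, nsmul_eq_mul]
    have hcard : (M.filter fun m' => (m - m').natAbs = n).card ≤ 2 := by
      refine (Finset.card_le_card (t := {m - n, m + n}) fun m' hm' => ?_).trans Finset.card_le_two
      have hn := (Finset.mem_filter.1 hm').2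
      simp only [Finset.mem_insert, Finset.mem_singleton]
      omega
    gcongr
    exact_mod_cast hcard
  refine (Finset.sum_le_sum hfib).trans ?_
  rw [← Finset.mul_sum]
  gcongr
  have := harmonic_le_one_add_log N
  simpa [harmonic] using this

/-! ### The two incidence bounds. -/

/-- Finitely many line pieces `S m` with angles `ϑ m` lying in distinct intervals of length `1 / R`,
each of them large and covered by the cells in `J`. -/
structure LineConfig (R a κ : ℝ) (J : Finset (ℤ × ℤ)) (M : Finset ℤ) (ϑ : ℤ → ℝ)
    (S : ℤ → Set (EuclideanSpace ℝ (Fin 2))) : Prop where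
  one_le : 1 ≤ R
  pos : 0 < a
  floor_eq : ∀ m ∈ M, ⌊R * ϑ m⌋ = m
  abs_sub_le : ∀ m ∈ M, ∀ m' ∈ M, |ϑ m - ϑ m'| ≤ 1
  line : ∀ m ∈ M, ∀ p ∈ S m, ∀ q ∈ S m, dist p q ≤ 2 ∧ ∃ t : ℝ, q - p = t • dirVec (ϑ m)
  cell_mem : ∀ m ∈ M, ∀ p ∈ S m, gridCell R p ∈ J
  le_content : ∀ m ∈ M, ENNReal.ofReal κ ≤ hausdorffContent a (S m)

namespace LineConfig

variable {R a κ : ℝ} {J : Finset (ℤ × ℤ)} {M : Finset ℤ} {ϑ : ℤ → ℝ}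
  {S : ℤ → Set (EuclideanSpace ℝ (Fin 2))}

theorem abs_cast_sub_le (h : LineConfig R a κ J M ϑ S) {m m' : ℤ} (hm : m ∈ M) (hm' : m' ∈ M) :
    |(m : ℝ) - m'| ≤ R * |ϑ m - ϑ m'| + 1 := by
  have hR : 0 < R := one_pos.trans_le h.one_le
  have h1 := Int.floor_eq_iff.1 (h.floor_eq m hm)
  have h2 := Int.floor_eq_iff.1 (h.floor_eq m' hm')
  have h4 : R * |ϑ m - ϑ m'| = |R * ϑ m - R * ϑ m'| := by rw [← mul_sub, abs_mul, abs_of_pos hR]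
  rw [h4]
  have h3 := abs_le.1 (le_refl |R * ϑ m - R * ϑ m'|)
  rw [abs_le]
  constructor <;> linarith [h1.1, h1.2, h2.1, h2.2, h3.1, h3.2]

theorem dist_mul_le (h : LineConfig R a κ J M ϑ S) {m m' : ℤ} (hm : m ∈ M) (hm' : m' ∈ M)
    {p q p' q' : EuclideanSpace ℝ (Fin 2)} (hp : p ∈ S m) (hq : q ∈ S m) (hp' : p' ∈ S m')
    (hq' : q' ∈ S m') (hpp : gridCell R p = gridCell R p') (hqq : gridCell R q = gridCell R q') :
    dist p q * (|(m : ℝ) - m'| - 1) ≤ 16 := by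
  have hR : 0 < R := one_pos.trans_le h.one_le
  obtain ⟨-, t, ht⟩ := h.line m hm p hp q hq
  obtain ⟨-, t', ht'⟩ := h.line m' hm' p' hp' q' hq'
  have h1 := dist_mul_abs_sub_le hR (h.abs_sub_le m hm m' hm') ht ht' hpp hqq
  have h2 := h.abs_cast_sub_le hm hm'
  rw [le_div_iff₀ hR] at h1
  calc dist p q * (|(m : ℝ) - m'| - 1) ≤ dist p q * (R * |ϑ m - ϑ m'|) := by
        gcongr; linarith
    _ ≤ 16 := by linarith

/-- The two-point bound: two well separated cells determine the direction of a line up to a bounded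
number of possibilities. -/
theorem card_mul_le_sq (h : LineConfig R a κ J M ϑ S) (hκ : 0 ≤ κ) {d : ℝ} (hd : 0 < d)
    (hd1 : d ≤ 1) (hdκ : (2 * d) ^ a ≤ κ / 2) :
    (M.card : ℝ) * (κ * (R / 2) ^ a) ^ 2 ≤ 70 / d * (J.card : ℝ) ^ 2 := by
  classical
  have hR : 0 < R := one_pos.trans_le h.one_le
  set A := κ * (R / 2) ^ a with hA
  have hA0 : 0 ≤ A := by positivity
  let r : ℤ → (ℤ × ℤ) × (ℤ × ℤ) → Prop := fun m zw =>
    ∃ p ∈ S m, ∃ q ∈ S m, gridCell R p = zw.1 ∧ gridCell R q = zw.2 ∧ d ≤ dist p q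
  have hlow : ∀ m ∈ M, A * (A / 2) ≤ (((J ×ˢ J).bipartiteAbove r m).card : ℝ) := by
    intro m hm
    set I := J.filter fun z => ∃ p ∈ S m, gridCell R p = z with hI
    have hIcard : A ≤ I.card := le_card_of_le_hausdorffContent h.pos hR
      (fun p hp => Finset.mem_filter.2 ⟨h.cell_mem m hm p hp, p, hp, rfl⟩) (h.le_content m hm)
    -- The ball of radius `d` around `p` has content at most `(2 * d) ^ a ≤ κ / 2`, so half of the
    -- content lies farther away.
    have hfar : ∀ z ∈ I, A / 2 ≤ ((J.filter fun w => r m (z, w)).card : ℝ) := by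
      intro z hz
      obtain ⟨-, p, hp, hpz⟩ := Finset.mem_filter.1 hz
      have hcont : ENNReal.ofReal (κ / 2) ≤ hausdorffContent a {q ∈ S m | d ≤ dist p q} := by
        have h1 : ENNReal.ofReal κ ≤ hausdorffContent a {q ∈ S m | d ≤ dist p q}
            + ENNReal.ofReal (κ / 2) := by
          refine (h.le_content m hm).trans ?_
          calc hausdorffContent a (S m)
              ≤ hausdorffContent a ({q ∈ S m | d ≤ dist p q} ∪ ball p d) := by
                refine measure_mono fun q hq => ?_
                rcases le_or_gt d (dist p q) with hle | hlt
                · exact Or.inl ⟨hq, hle⟩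
                · exact Or.inr (mem_ball'.2 hlt)
            _ ≤ _ := measure_union_le _ _
            _ ≤ _ := by
                gcongr
                refine (hausdorffContent_le_ediam_rpow _).trans ?_
                refine le_trans ?_ (ENNReal.ofReal_le_ofReal hdκ)
                rw [← ENNReal.ofReal_rpow_of_pos (by positivity)]
                refine ENNReal.rpow_le_rpow (ediam_le fun x hx y hy => ?_) h.pos.le
                rw [edist_dist]
                refine ENNReal.ofReal_le_ofReal ?_
                linarith [dist_triangle_right x y p, mem_ball.1 hx, mem_ball.1 hy]
        have h2 : ENNReal.ofReal κ = ENNReal.ofReal (κ / 2) + ENNReal.ofReal (κ / 2) := by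
          rw [← ENNReal.ofReal_add (by positivity) (by positivity), add_halves]
        rw [h2] at h1
        exact (ENNReal.add_le_add_iff_right ENNReal.ofReal_ne_top).1 h1
      have := le_card_of_le_hausdorffContent (T := J.filter fun w => r m (z, w)) h.pos hR
        (fun q hq => Finset.mem_filter.2
          ⟨h.cell_mem m hm q hq.1, p, hp, q, hq.1, hpz, rfl, hq.2⟩) hcont
      calc A / 2 = κ / 2 * (R / 2) ^ a := by rw [hA]; ring
        _ ≤ _ := this
    calc A * (A / 2) ≤ I.card * (A / 2) := by gcongr
      _ = ∑ z ∈ I, A / 2 := by simp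
      _ ≤ ∑ z ∈ I, ((J.filter fun w => r m (z, w)).card : ℝ) := Finset.sum_le_sum hfar
      _ ≤ ∑ z ∈ J, ((J.filter fun w => r m (z, w)).card : ℝ) :=
          Finset.sum_le_sum_of_subset_of_nonneg (Finset.filter_subset _ _) fun _ _ _ => by positivity
      _ = (((J ×ˢ J).bipartiteAbove r m).card : ℝ) := by
          rw [Finset.bipartiteAbove, Finset.card_filter, Finset.sum_product, Nat.cast_sum]
          exact Finset.sum_congr rfl fun z _ => by rw [Finset.card_filter]
  -- The labels differ by at most `16 / d + 1`, and `2 * (16 / d + 1) + 1 ≤ 35 / d` since `d ≤ 1`.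
  have hup : ∀ zw ∈ J ×ˢ J, ((M.bipartiteBelow r zw).card : ℝ) ≤ 35 / d := by
    intro zw _
    have hB : ∀ m ∈ M.bipartiteBelow r zw, ∀ m' ∈ M.bipartiteBelow r zw,
        |(m : ℝ) - m'| ≤ 16 / d + 1 := by
      intro m hm m' hm'
      rw [Finset.mem_bipartiteBelow] at hm hm'
      obtain ⟨hm, p, hp, q, hq, hpz, hqw, hpq⟩ := hm
      obtain ⟨hm', p', hp', q', hq', hpz', hqw', -⟩ := hm'
      have h1 := h.dist_mul_le hm hm' hp hq hp' hq' (hpz.trans hpz'.symm) (hqw.trans hqw'.symm)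
      rcases le_or_gt (|(m : ℝ) - m'|) 1 with h2 | h2
      · have : 0 < 16 / d := by positivity
        linarith
      · have h3 : (|(m : ℝ) - m'| - 1) ≤ 16 / d := by
          rw [le_div_iff₀ hd]
          nlinarith
        linarith
    refine (card_le_of_abs_sub_le (by positivity) hB).trans ?_
    rw [le_div_iff₀ hd]
    field_simp
    linarith
  have hsum := Finset.sum_card_bipartiteAbove_eq_sum_card_bipartiteBelow (s := M) (t := J ×ˢ J) r
  have hsum' : ∑ m ∈ M, (((J ×ˢ J).bipartiteAbove r m).card : ℝ)
      = ∑ zw ∈ J ×ˢ J, ((M.bipartiteBelow r zw).card : ℝ) := by exact_mod_cast hsum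
  have h1 : (M.card : ℝ) * (A * (A / 2)) ≤ ∑ m ∈ M, (((J ×ˢ J).bipartiteAbove r m).card : ℝ) := by
    rw [← nsmul_eq_mul]
    exact Finset.card_nsmul_le_sum _ _ _ hlow
  have h2 : ∑ zw ∈ J ×ˢ J, ((M.bipartiteBelow r zw).card : ℝ) ≤ (J ×ˢ J).card * (35 / d) := by
    rw [← nsmul_eq_mul]
    exact Finset.sum_le_card_nsmul _ _ _ hup
  rw [Finset.card_product, Nat.cast_mul] at h2
  have h3 : (70 : ℝ) / d = 2 * (35 / d) := by ring
  rw [h3]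
  nlinarith

/-- Two lines share few cells. -/
theorem card_inter_le (h : LineConfig R a κ J M ϑ S) {m m' : ℤ} (hm : m ∈ M) (hm' : m' ∈ M)
    {T : Finset (ℤ × ℤ)} (hT : ∀ z ∈ T, ∃ p ∈ S m, gridCell R p = z)
    (hT' : ∀ z ∈ T, ∃ p ∈ S m', gridCell R p = z) :
    (T.card : ℝ) ≤ 918 * R * (1 / (|(m : ℝ) - m'| + 1)) := by
  have hR : 0 < R := one_pos.trans_le h.one_le
  set n := |(m : ℝ) - m'| with hn
  have hn0 : 0 ≤ n := abs_nonneg _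
  have hnR : n + 1 ≤ 3 * R := by
    have h1 := h.abs_cast_sub_le hm hm'
    have h2 := h.abs_sub_le m hm m' hm'
    nlinarith [h.one_le]
  -- The bounds `dist * (n - 1) ≤ 16` and `dist ≤ 2` give `dist * (n + 1) ≤ 20`, within the allowed
  -- `48`. With `n + 1 ≤ 3 * R`, the constant is `918 = 9 * (2 * 48 + 2 * 3)`.
  have hcard := card_le_of_subset_line (R := R) (D := 48 / (n + 1)) (θ := ϑ m)
    (S := {p ∈ S m | ∃ p' ∈ S m', gridCell R p = gridCell R p'}) (T := T) hR (by positivity)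
    (by
      rintro p ⟨hp, p', hp', hpp⟩ q ⟨hq, q', hq', hqq⟩
      refine ⟨?_, (h.line m hm p hp q hq).2⟩
      have h1 := (h.line m hm p hp q hq).1
      have h2 := h.dist_mul_le hm hm' hp hq hp' hq' hpp hqq
      rw [← hn] at h2
      rw [le_div_iff₀ (by positivity)]
      nlinarith [dist_nonneg (x := p) (y := q)])
    (by
      intro z hz
      obtain ⟨p, hp, hpz⟩ := hT z hz
      obtain ⟨p', hp', hpz'⟩ := hT' z hz
      exact ⟨p, ⟨hp, p', hp', hpz.trans hpz'.symm⟩, hpz⟩)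
  refine hcard.trans ?_
  rw [mul_one_div, le_div_iff₀ (by positivity)]
  have : R * (48 / (n + 1)) * (n + 1) = 48 * R := by field_simp
  nlinarith

/-- The bound obtained from counting pairs of lines through a common cell. -/
theorem sq_card_mul_le (h : LineConfig R a κ J M ϑ S) (hκ : 0 ≤ κ) {N : ℕ} (hN : R + 1 < N) :
    (M.card : ℝ) * (κ * (R / 2) ^ a) ^ 2
      ≤ J.card * (918 * R * (2 * (1 + Real.log N))) := by
  classical
  have hR : 0 < R := one_pos.trans_le h.one_le
  set A := κ * (R / 2) ^ a with hA
  have hA0 : 0 ≤ A := by positivity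
  rcases M.eq_empty_or_nonempty with rfl | hM
  · have : 0 ≤ Real.log N := Real.log_natCast_nonneg N
    simp
    positivity
  let I : ℤ → Finset (ℤ × ℤ) := fun m => J.filter fun z => ∃ p ∈ S m, gridCell R p = z
  have hI : ∀ m ∈ M, A ≤ (I m).card := fun m hm => le_card_of_le_hausdorffContent h.pos hR
      (fun p hp => Finset.mem_filter.2 ⟨h.cell_mem m hm p hp, p, hp, rfl⟩) (h.le_content m hm)
  have hcs := sq_sum_card_le M J I fun m _ => Finset.filter_subset _ _
  have hlow : (M.card : ℝ) * A ≤ ∑ m ∈ M, ((I m).card : ℝ) := by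
    rw [← nsmul_eq_mul]
    exact Finset.card_nsmul_le_sum _ _ _ hI
  have hup : ∑ m ∈ M, ∑ m' ∈ M, ((I m ∩ I m').card : ℝ)
      ≤ M.card * (918 * R * (2 * (1 + Real.log N))) := by
    rw [← nsmul_eq_mul]
    refine Finset.sum_le_card_nsmul _ _ _ fun m hm => ?_
    calc ∑ m' ∈ M, ((I m ∩ I m').card : ℝ)
        ≤ ∑ m' ∈ M, 918 * R * (1 / (|(m : ℝ) - m'| + 1)) :=
          Finset.sum_le_sum fun m' hm' => h.card_inter_le hm hm'
            (fun z hz => (Finset.mem_filter.1 (Finset.mem_inter.1 hz).1).2)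
            (fun z hz => (Finset.mem_filter.1 (Finset.mem_inter.1 hz).2).2)
      _ = 918 * R * ∑ m' ∈ M, 1 / (|(m : ℝ) - m'| + 1) := by rw [Finset.mul_sum]
      _ ≤ _ := by
          gcongr
          refine sum_inv_abs_sub_le M m N fun m' hm' => ?_
          have h1 := h.abs_cast_sub_le hm hm'
          have h2 := h.abs_sub_le m hm m' hm'
          have h3 : (((m - m').natAbs : ℕ) : ℝ) < N := by
            rw [Nat.cast_natAbs]
            push_cast
            nlinarith
          exact_mod_cast h3
  have hMpos : (0 : ℝ) < M.card := by exact_mod_cast hM.card_pos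
  have h1 : ((M.card : ℝ) * A) ^ 2
      ≤ J.card * (M.card * (918 * R * (2 * (1 + Real.log N)))) := by
    refine le_trans ?_ (hcs.trans ?_)
    · gcongr
    · gcongr
  refine le_of_mul_le_mul_left ?_ hMpos
  calc (M.card : ℝ) * (M.card * A ^ 2) = (M.card * A) ^ 2 := by ring
    _ ≤ _ := h1
    _ = _ := by ring

end LineConfig

/-! ### From counting to dimension. -/

/-- One good angle is kept from each occupied interval of length `1 / R`; the content of the good
angles forces many such intervals. -/
theorem IsFurstenbergSet.exists_lineConfig {α β : ℝ} {E : Set (EuclideanSpace ℝ (Fin 2))}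
    (hE : IsFurstenbergSet α β E) {a b s η : ℝ} (ha : 0 < a) (hb : 0 < b) (haα : a < α)
    (hbβ : b < β) (hs : 0 < s) (hη : 0 < η) (hdim : dimH E < ENNReal.ofReal s) (k₀ : ℕ) :
    ∃ (k : ℕ) (J : Finset (ℤ × ℤ)) (M : Finset ℤ) (ϑ : ℤ → ℝ)
      (S : ℤ → Set (EuclideanSpace ℝ (Fin 2))), k₀ ≤ k ∧
      LineConfig (2 ^ k) a ((2 : ℝ) ^ (-(η * k))) J M ϑ S ∧
      (J.card : ℝ) ≤ 9 * (2 : ℝ) ^ ((k + 1) * s) ∧ (2 : ℝ) ^ (-(η * k) + k * b) ≤ M.card := by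
  classical
  obtain ⟨x, Θ, S, c, hc, hΘx, hΘ, hS⟩ := hE.exists_angles ha hb haα hbβ
  obtain ⟨k, J, hk, hJ, hcont⟩ := exists_scale hs ha hη hdim hc hΘ
    (fun θ hθ => ⟨(hS θ hθ).1, (hS θ hθ).2.1⟩) k₀
  set R : ℝ := 2 ^ k with hR
  have hRpos : 0 < R := by positivity
  set S' : ℝ → Set (EuclideanSpace ℝ (Fin 2)) := fun θ => {p ∈ S θ | gridCell R p ∈ J}
  set Θ' : Set ℝ := {θ ∈ Θ | ENNReal.ofReal ((2 : ℝ) ^ (-(η * k))) ≤ hausdorffContent a (S' θ)}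
  set M : Finset ℤ := (Finset.Icc ⌊R * x⌋ ⌊R * (x + 1)⌋).filter fun m => ∃ θ ∈ Θ', ⌊R * θ⌋ = m
  have hM : ∀ m, ∃ θ, m ∈ M → θ ∈ Θ' ∧ ⌊R * θ⌋ = m := fun m => by
    by_cases hm : m ∈ M
    · obtain ⟨θ, h1, h2⟩ := (Finset.mem_filter.1 hm).2
      exact ⟨θ, fun _ => ⟨h1, h2⟩⟩
    · exact ⟨0, fun h => absurd h hm⟩
  choose ϑ hϑ using hM
  refine ⟨k, J, M, ϑ, fun m => S' (ϑ m), hk, ?_, hJ, ?_⟩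
  · refine ⟨one_le_pow₀ one_le_two, ha, fun m hm => (hϑ m hm).2, fun m hm m' hm' => ?_,
      fun m hm p hp q hq => (hS _ (hϑ m hm).1.1).2.2 p hp.1 q hq.1, fun m hm p hp => hp.2,
      fun m hm => (hϑ m hm).1.2⟩
    have h1 := hΘx (hϑ m hm).1.1
    have h2 := hΘx (hϑ m' hm').1.1
    rw [abs_le]
    constructor <;> linarith [h1.1, h1.2, h2.1, h2.2]
  · have h1 := hcont.trans (hausdorffContent_le_card_mul (fun θ : ℝ => ⌊R * θ⌋) M
      (r := ENNReal.ofReal (1 / R)) hb (fun θ hθ => by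
        have h := hΘx hθ.1
        refine Finset.mem_filter.2 ⟨Finset.mem_Icc.2 ⟨Int.floor_mono ?_, Int.floor_mono ?_⟩,
          θ, hθ, rfl⟩
        · exact mul_le_mul_of_nonneg_left h.1 hRpos.le
        · exact mul_le_mul_of_nonneg_left h.2 hRpos.le)
      fun θ _ θ' _ hθθ => by
        rw [edist_dist, Real.dist_eq]
        refine ENNReal.ofReal_le_ofReal ?_
        have h := Int.abs_sub_lt_one_of_floor_eq_floor hθθ
        rw [← mul_sub, abs_mul, abs_of_pos hRpos] at h
        rw [le_div_iff₀ hRpos]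
        linarith)
    rw [ENNReal.ofReal_rpow_of_pos (by positivity), ← ENNReal.ofReal_natCast,
      ← ENNReal.ofReal_mul (by positivity), ENNReal.ofReal_le_ofReal_iff (by positivity)] at h1
    have h2 : (1 / R) ^ b * (2 : ℝ) ^ (k * b) = 1 := by
      rw [hR, ← Real.rpow_natCast, one_div, ← Real.rpow_neg two_pos.le, ← Real.rpow_mul two_pos.le,
        ← Real.rpow_add two_pos]
      simp
    rw [Real.rpow_add two_pos]
    calc (2 : ℝ) ^ (-(η * k)) * 2 ^ (k * b) ≤ M.card * (1 / R) ^ b * 2 ^ (k * b) := by gcongr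
      _ = M.card := by rw [mul_assoc, h2, mul_one]

theorem two_rpow_le_card_mul_sq {k n : ℕ} {a b η : ℝ}
    (h : (2 : ℝ) ^ (-(η * k) + k * b) ≤ n) :
    (2 : ℝ) ^ (k * b - 3 * (η * k) + 2 * (k - 1) * a)
      ≤ n * ((2 : ℝ) ^ (-(η * k)) * ((2 : ℝ) ^ k / 2) ^ a) ^ 2 := by
  have h1 : ((2 : ℝ) ^ (-(η * k)) * ((2 : ℝ) ^ k / 2) ^ a) ^ 2
      = (2 : ℝ) ^ (-2 * (η * k) + 2 * (k - 1) * a) := by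
    have : (2 : ℝ) ^ k / 2 = (2 : ℝ) ^ ((k : ℝ) - 1) := by
      rw [Real.rpow_sub_one two_ne_zero, Real.rpow_natCast]
    rw [this, ← Real.rpow_mul two_pos.le, ← Real.rpow_add two_pos, ← Real.rpow_natCast,
      ← Real.rpow_mul two_pos.le]
    congr 1
    push_cast
    ring
  rw [h1]
  calc (2 : ℝ) ^ (k * b - 3 * (η * k) + 2 * (k - 1) * a)
      = (2 : ℝ) ^ (-(η * k) + k * b) * (2 : ℝ) ^ (-2 * (η * k) + 2 * (k - 1) * a) := by
        rw [← Real.rpow_add two_pos]; congr 1; ring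
    _ ≤ _ := by gcongr

theorem IsFurstenbergSet.add_half_le {α β : ℝ} {E : Set (EuclideanSpace ℝ (Fin 2))}
    (hE : IsFurstenbergSet α β E) {a b s : ℝ} (ha : 0 < a) (hb : 0 < b) (haα : a < α)
    (hbβ : b < β) (hs : 0 < s) (hdim : dimH E < ENNReal.ofReal s) : 2 * a + b ≤ 2 * s := by
  by_contra! hlt
  set g := 2 * a + b - 2 * s with hg
  have hg0 : 0 < g := by linarith
  -- The loss in the exponent is `3 * η` from `M * A ^ 2` and `η / a` from `1 / d`: in total half
  -- the gap `g`.
  set η := g / (2 * (3 + 1 / a)) with hηdef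
  have hη : 0 < η := by positivity
  have hηg : η * (3 + 1 / a) = g / 2 := by rw [hηdef]; field_simp
  obtain ⟨k₀, hk₀⟩ := exists_nat_gt ((14 + 1 / a + 2 * s + 2 * a) / (g / 2))
  obtain ⟨k, J, M, ϑ, S, hk, hconf, hJ, hM⟩ :=
    hE.exists_lineConfig ha hb haα hbβ hs hη hdim k₀
  set κ := (2 : ℝ) ^ (-(η * k)) with hκ
  have hκ1 : κ ≤ 1 := Real.rpow_le_one_of_one_le_of_nonpos one_le_two (by
    have : 0 ≤ η * k := by positivity
    linarith)
  -- This `d` solves `(2 * d) ^ a = κ / 2`.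
  have hd : (2 : ℝ) ^ (-1 - (1 + η * k) / a) * 2 = (κ / 2) ^ (1 / a) := by
    rw [hκ, ← Real.rpow_sub_one two_ne_zero, ← Real.rpow_mul two_pos.le, ← Real.rpow_add_one two_ne_zero]
    congr 1
    field_simp
    ring
  have hmain := hconf.card_mul_le_sq (by positivity) (d := (2 : ℝ) ^ (-1 - (1 + η * k) / a))
    (by positivity)
    (Real.rpow_le_one_of_one_le_of_nonpos one_le_two (by
      have : 0 ≤ (1 + η * k) / a := by positivity
      linarith))
    (by
      rw [mul_comm, hd, ← Real.rpow_mul (by positivity), one_div_mul_cancel ha.ne', Real.rpow_one])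
  have h1 := (two_rpow_le_card_mul_sq (a := a) hM).trans hmain
  have h2 : 70 / (2 : ℝ) ^ (-1 - (1 + η * k) / a) * (J.card : ℝ) ^ 2
      ≤ (2 : ℝ) ^ (14 + (1 + η * k) / a + 2 * ((k + 1) * s)) := by
    calc 70 / (2 : ℝ) ^ (-1 - (1 + η * k) / a) * (J.card : ℝ) ^ 2
        ≤ 70 / (2 : ℝ) ^ (-1 - (1 + η * k) / a) * (9 * (2 : ℝ) ^ ((k + 1) * s)) ^ 2 := by gcongr
      _ = 5670 * (2 : ℝ) ^ (1 + (1 + η * k) / a + 2 * ((k + 1) * s)) := by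
          rw [mul_pow, ← Real.rpow_natCast (2 ^ ((k + 1) * s)), ← Real.rpow_mul two_pos.le,
            div_eq_mul_inv, ← Real.rpow_neg two_pos.le]
          rw [show (1 + (1 + η * k) / a + 2 * ((k + 1) * s))
            = -(-1 - (1 + η * k) / a) + ((k + 1) * s) * ((2 : ℕ) : ℝ) by push_cast; ring,
            Real.rpow_add two_pos]
          ring
      _ ≤ (2 : ℝ) ^ (13 : ℝ) * (2 : ℝ) ^ (1 + (1 + η * k) / a + 2 * ((k + 1) * s)) := by
          gcongr
          norm_num
      _ = _ := by rw [← Real.rpow_add two_pos]; congr 1; ring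
  have h3 := (Real.rpow_le_rpow_left_iff one_lt_two).1 (h1.trans h2)
  have h4 : (14 + 1 / a + 2 * s + 2 * a) < k * (g / 2) := by
    rw [div_lt_iff₀ (by positivity)] at hk₀
    have : (k₀ : ℝ) ≤ k := by exact_mod_cast hk
    nlinarith
  have h5 : (1 + η * k) / a = 1 / a + k * (η * (1 / a)) := by ring
  rw [h5] at h3
  have h6 : (k : ℝ) * (η * (3 + 1 / a)) = k * (g / 2) := by rw [hηg]
  have h7 : (k : ℝ) * g = k * (2 * a + b - 2 * s) := by rw [hg]
  linarith

theorem IsFurstenbergSet.two_mul_add_le {α β : ℝ} {E : Set (EuclideanSpace ℝ (Fin 2))}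
    (hE : IsFurstenbergSet α β E) {a b s : ℝ} (ha : 0 < a) (hb : 0 < b) (haα : a < α)
    (hbβ : b < β) (hs : 0 < s) (hdim : dimH E < ENNReal.ofReal s) : 2 * a + b ≤ s + 1 := by
  by_contra! hlt
  set g := 2 * a + b - 1 - s with hg
  have hg0 : 0 < g := by linarith
  -- Three factors `2 ^ (η * k)` are lost in `M * A ^ 2` and a fourth absorbs the logarithm: again
  -- half of `g`.
  set η := g / 8 with hηdef
  have hη : 0 < η := by positivity
  obtain ⟨k₀, hk₀⟩ := exists_nat_gt ((15 + s + 2 * a) / (g / 2))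
  have hgrow : ∀ᶠ k : ℕ in Filter.atTop, (k : ℝ) + 3 ≤ (2 : ℝ) ^ (η * k) := by
    have ht := tendsto_pow_const_div_const_pow_of_one_lt 1
      (Real.one_lt_rpow one_lt_two hη)
    filter_upwards [ht.eventually (gt_mem_nhds (show (0 : ℝ) < 1 / 4 by norm_num)),
      Filter.eventually_ge_atTop 1] with k hk hk1
    rw [pow_one, ← Real.rpow_natCast, ← Real.rpow_mul two_pos.le, div_lt_iff₀ (by positivity)] at hk
    have : (1 : ℝ) ≤ k := by exact_mod_cast hk1
    linarith
  obtain ⟨k₁, hk₁⟩ := Filter.eventually_atTop.1 hgrow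
  obtain ⟨k, J, M, ϑ, S, hk, hconf, hJ, hM⟩ :=
    hE.exists_lineConfig ha hb haα hbβ hs hη hdim (max k₀ k₁)
  have hN : (2 : ℝ) ^ k + 1 < ((2 ^ (k + 2) : ℕ) : ℝ) := by
    have : (1 : ℝ) ≤ 2 ^ k := one_le_pow₀ one_le_two
    push_cast
    rw [pow_add]
    linarith
  have hlog : 1 + Real.log ((2 ^ (k + 2) : ℕ) : ℝ) ≤ (2 : ℝ) ^ (η * k) := by
    refine le_trans ?_ (hk₁ k ((le_max_right _ _).trans hk))
    rw [Nat.cast_pow, Real.log_pow]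
    push_cast
    nlinarith [Real.log_two_lt_d9, Real.log_two_gt_d9]
  have hmain := hconf.sq_card_mul_le (by positivity) hN
  have h1 := (two_rpow_le_card_mul_sq (a := a) hM).trans hmain
  have h2 : (J.card : ℝ) * (918 * 2 ^ k * (2 * (1 + Real.log ((2 ^ (k + 2) : ℕ) : ℝ))))
      ≤ (2 : ℝ) ^ (15 + (k + 1) * s + k + η * k) := by
    have hl0 : 0 ≤ Real.log ((2 ^ (k + 2) : ℕ) : ℝ) := Real.log_natCast_nonneg _
    calc (J.card : ℝ) * (918 * 2 ^ k * (2 * (1 + Real.log ((2 ^ (k + 2) : ℕ) : ℝ))))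
        ≤ (9 * (2 : ℝ) ^ ((k + 1) * s)) * (918 * 2 ^ k * (2 * (2 : ℝ) ^ (η * k))) := by gcongr
      _ = 16524 * ((2 : ℝ) ^ ((k + 1) * s) * (2 : ℝ) ^ (k : ℝ) * (2 : ℝ) ^ (η * k)) := by
          rw [Real.rpow_natCast]; ring
      _ ≤ (2 : ℝ) ^ (15 : ℝ) * ((2 : ℝ) ^ ((k + 1) * s) * (2 : ℝ) ^ (k : ℝ) * (2 : ℝ) ^ (η * k)) := by
          gcongr
          norm_num
      _ = _ := by
          rw [← Real.rpow_add two_pos, ← Real.rpow_add two_pos, ← Real.rpow_add two_pos]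
          congr 1; ring
  have h3 := (Real.rpow_le_rpow_left_iff one_lt_two).1 (h1.trans h2)
  have h4 : (15 + s + 2 * a) < k * (g / 2) := by
    rw [div_lt_iff₀ (by positivity)] at hk₀
    have : (k₀ : ℝ) ≤ k := by exact_mod_cast (le_max_left _ _).trans hk
    nlinarith
  have h6 : η * (k : ℝ) = k * g / 8 := by rw [hηdef]; ring
  have h7 : (k : ℝ) * g = k * (2 * a + b - 1 - s) := by rw [hg]
  rw [h6] at h3
  linarith

theorem mainTheorem8 (α β : ℝ) (hα : 0 < α) (hα1 : α ≤ 1) (hβ : 0 < β) (hβ1 : β ≤ 1)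
    (E : Set (EuclideanSpace ℝ (Fin 2))) (hE : IsFurstenbergSet α β E) :
    ENNReal.ofReal (max (2 * α + β - 1) (β / 2 + α)) ≤ dimH E := by
  by_contra! hlt
  obtain ⟨s, hs0, hEs, hs⟩ := ENNReal.lt_iff_exists_real_btwn.1 hlt
  have hspos : 0 < s := ENNReal.ofReal_pos.1 (bot_le.trans_lt hEs)
  replace hs := (ENNReal.ofReal_lt_ofReal_iff_of_nonneg hs0).1 hs
  set g := max (2 * α + β - 1) (β / 2 + α) - s with hg
  have hg0 : 0 < g := by linarith
  -- Lowering both exponents by `u` costs `3 * u < g` in `2 * a + b`, and `a`, `b` stay positive.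
  set u := min (min (α / 2) (β / 2)) (g / 4) with hu
  have hu0 : 0 < u := lt_min (lt_min (by positivity) (by positivity)) (by positivity)
  have huα : u ≤ α / 2 := (min_le_left _ _).trans (min_le_left _ _)
  have huβ : u ≤ β / 2 := (min_le_left _ _).trans (min_le_right _ _)
  have hug : u ≤ g / 4 := min_le_right _ _
  have h1 := hE.two_mul_add_le (a := α - u) (b := β - u) (by linarith) (by linarith) (by linarith)
    (by linarith) hspos hEs
  have h2 := hE.add_half_le (a := α - u) (b := β - u) (by linarith) (by linarith) (by linarith)
    (by linarith) hspos hEs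
  rcases max_cases (2 * α + β - 1) (β / 2 + α) with ⟨h, -⟩ | ⟨h, -⟩ <;> rw [h] at hg <;> linarith
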